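/- **Theorem.** Let $p\ge 3$ be a prime. For $N\ge 0$ let row $N$ be the finite string of coefficients $c_0c_1\cdots c_N$, reduced modulo $p$, of $(1+x)^N=\sum_{i=0}^N c_ix^i$. For $m\ge 0$, let $a(m)$ be the number of accessible $m$-blocks, i.e. of strings of $m$ digits modulo $p$ that occur as a contiguous substring of row $N$ for some $N\ge 0$ (the empty block is the only $0$-block). Then $$a(0)=1,\qquad a(1)=p,\qquad a(2)=p^2,$$ and for all integers $n\ge 0$ and $0\le k\le p-1$ with $pn+k\ge 3$, $$a(pn+k)=\frac{(p-k)(p-k+1)}{2}\,a(n)+\Big(kp+k-k^2+\frac{p^2-p}{2}\Big)a(n+1)+\frac{k^2-k}{2}\,a(n+2)-(2p-1)(2p-2).$$ -/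

import Mathlib

open Polynomial

/-- Row `N` for `f` and `p`: the power `f ^ N` with its coefficients reduced modulo `p`. -/
noncomputable def row (p : ℕ) (f : ℤ[X]) (N : ℕ) : (ZMod p)[X] :=
  (f ^ N).map (Int.castRingHom (ZMod p))

/-- An `m`-block `b` (a string of `m` digits modulo `p`) is accessible for `f` and `p` if, for
some `N`, it is a contiguous substring of the list of coefficients `c₀, c₁, …, c_d` of row `N`,
where `d` is the degree of that row. -/
def IsAccessible (p : ℕ) (f : ℤ[X]) {m : ℕ} (b : Fin m → ZMod p) : Prop :=
  ∃ N j : ℕ, j + m ≤ (row p f N).natDegree + 1 ∧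
    ∀ i : Fin m, b i = (row p f N).coeff (j + (i : ℕ))

/-- The number `a_{f,p}(m)` of accessible `m`-blocks for `f` and `p`. -/
noncomputable def numAccessible (f : ℤ[X]) (p m : ℕ) : ℕ :=
  {b : Fin m → ZMod p | IsAccessible p f b}.ncard

/-!
Sort the occurrences of an `m`-block, at position `j` of row `N`, by the residues `ρ` of `N` and `α`
of `j` modulo `p`, and let `classBlocks m ρ α` be the set of blocks occurring in the class `(ρ, α)`.
The recursion for the number of accessible blocks is a double count of the pairs consisting of a
class and a block occurring in it.

*Size of a class.* By Lucas' congruence, row `pN + r` arises from row `N` by the substitution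
`d ↦ d * (C(r,0), …, C(r,p-1))`. So the `m`-blocks of one class are the images of the accessible
`L`-blocks under an injective map (`substBlock_injective`, `substBlock_image`), where `L` is `n`,
`n + 1` or `n + 2` if `m = pn + k` (`ncard_classBlocks`). Surjectivity uses that an accessible block
also occurs away from the ends of a row (`exists_padded_occurrence`). Adding up the `p ^ 2` classes
gives the main terms of the recursion (`sum_sum_preimageLength`).

*Overlaps.* The identity `(j + 1) C(N, j + 1) = (N - j) C(N, j)` shows that a block `b` of the class
`(ρ, α)` satisfies `(α + i + 1) b (i + 1) = (ρ - α - i) b i`. If `b` lies in two classes, the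
difference of the two recurrences has constant coefficients and forces `b` to be one of
`c 0 ⋯ 0`, `0 ⋯ 0 c`, or `c, -c, c, …` when `m ≥ 3` (`eq_special_of_mem_two_classes`). The zero
block lies in all `p ^ 2` classes, and for `c ≠ 0` these three blocks lie in the `p` classes given
by `α = ρ`, by `α = 1 - m` and by `ρ = -1`, respectively. So the sum of the class sizes exceeds the
number of accessible blocks by
`(p ^ 2 - 1) + 3 (p - 1) (p - 1) = (2 p - 1) (2 p - 2)` (`sum_ncard_classBlocks`).
-/

/-! ### Coefficients of a row -/

theorem row_one_add_X_coeff (p N j : ℕ) :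
    (row p (1 + X) N).coeff j = (N.choose j : ZMod p) := by
  rw [row, coeff_map, coeff_one_add_X_pow]
  simp

theorem row_one_add_X_natDegree (p N : ℕ) (hp : p.Prime) :
    (row p (1 + X) N).natDegree = N := by
  have := Fact.mk hp
  rw [row, Polynomial.map_pow, natDegree_pow]
  have : ((1 + X : ℤ[X]).map (Int.castRingHom (ZMod p))).natDegree = 1 := by
    rw [Polynomial.map_add, Polynomial.map_one, map_X, add_comm, ← C_1, natDegree_X_add_C]
  rw [this, mul_one]

theorem isAccessible_one_add_X_iff {p m : ℕ} (hp : p.Prime) (b : Fin m → ZMod p) :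
    IsAccessible p (1 + X) b ↔
      ∃ N j : ℕ, j + m ≤ N + 1 ∧ ∀ i : Fin m, b i = (N.choose (j + i) : ZMod p) := by
  simp only [IsAccessible, row_one_add_X_coeff, row_one_add_X_natDegree p _ hp]

/-- The relation between consecutive binomial coefficients, as an identity in a ring and without
subtraction of natural numbers. -/
theorem cast_succ_mul_choose_succ {R : Type*} [Ring R] (N j : ℕ) :
    ((j : R) + 1) * (N.choose (j + 1) : R) = ((N : R) - j) * (N.choose j : R) := by
  have h : (j + 1) * N.choose (j + 1) + j * N.choose j = N * N.choose j := by
    rcases le_or_gt j N with hj | hj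
    · have := Nat.choose_succ_right_eq N j
      obtain ⟨d, rfl⟩ := Nat.exists_eq_add_of_le hj
      rw [Nat.add_sub_cancel_left] at this
      linarith
    · simp [Nat.choose_eq_zero_of_lt hj, Nat.choose_eq_zero_of_lt (hj.trans (Nat.lt_succ_self j))]
  have h' := congrArg (Nat.cast (R := R)) h
  push_cast at h'
  rw [sub_mul, ← h', add_sub_cancel_right]

section Prime

variable {p : ℕ} [Fact p.Prime]

theorem cast_choose_lucas {u v r t : ℕ} (hr : r < p) (ht : t < p) :
    ((p * u + r).choose (p * v + t) : ZMod p) = (u.choose v : ZMod p) * (r.choose t : ZMod p) := by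
  have h := Choose.choose_modEq_choose_mod_mul_choose_div_nat (p := p) (n := p * u + r)
    (k := p * v + t)
  have hp : 0 < p := by omega
  rw [Nat.mul_add_mod, Nat.mul_add_mod, Nat.mod_eq_of_lt hr, Nat.mod_eq_of_lt ht,
    Nat.mul_add_div hp, Nat.mul_add_div hp, Nat.div_eq_of_lt hr, Nat.div_eq_of_lt ht,
    ← ZMod.natCast_eq_natCast_iff] at h
  simpa [mul_comm] using h

/-- Lucas' congruence with respect to a power of `p`. -/
theorem cast_choose_lucas_pow (k : ℕ) {u v r t : ℕ} (hr : r < p ^ k) (ht : t < p ^ k) :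
    ((p ^ k * u + r).choose (p ^ k * v + t) : ZMod p) =
      (u.choose v : ZMod p) * (r.choose t : ZMod p) := by
  have hp : 0 < p := (Fact.out : p.Prime).pos
  induction k generalizing r t with
  | zero =>
    simp only [pow_zero, Nat.lt_one_iff] at hr ht
    simp [hr, ht]
  | succ k ih =>
    have key (x y : ℕ) : p ^ (k + 1) * x + y = p * (p ^ k * x + y / p) + y % p := by
      conv_lhs => rw [← Nat.div_add_mod y p]
      ring
    have hd {y : ℕ} (hy : y < p ^ (k + 1)) : y / p < p ^ k :=
      Nat.div_lt_of_lt_mul (by rwa [pow_succ'] at hy)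
    have hm (y : ℕ) : y % p < p := Nat.mod_lt _ hp
    rw [key u r, key v t, cast_choose_lucas (hm r) (hm t), ih (hd hr) (hd ht), mul_assoc,
      ← cast_choose_lucas (hm r) (hm t), Nat.div_add_mod, Nat.div_add_mod]

theorem cast_choose_ne_zero {r s : ℕ} (hr : r < p) (hs : s ≤ r) :
    (r.choose s : ZMod p) ≠ 0 := by
  have hp : p.Prime := Fact.out
  rw [Ne, ZMod.natCast_eq_zero_iff]
  intro h
  have h1 : p ∣ r.factorial := by
    rw [← Nat.choose_mul_factorial_mul_factorial hs, mul_assoc]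
    exact h.mul_right _
  exact absurd ((hp.dvd_factorial).1 h1) (by omega)

theorem cast_choose_pow_sub_one (k : ℕ) {t : ℕ} (ht : t < p ^ k) :
    ((p ^ k - 1).choose t : ZMod p) = (-1) ^ t := by
  have hp : p.Prime := Fact.out
  induction t with
  | zero => simp
  | succ t ih =>
    have h0 : ((p ^ k).choose (t + 1) : ZMod p) = 0 := by
      have := cast_choose_lucas_pow (p := p) k (u := 1) (v := 0) (r := 0) (t := t + 1)
        (pow_pos hp.pos k) ht
      simpa using this
    have h1 : (p ^ k).choose (t + 1) = (p ^ k - 1).choose t + (p ^ k - 1).choose (t + 1) := by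
      conv_lhs => rw [show p ^ k = (p ^ k - 1) + 1 by have := pow_pos hp.pos k; omega]
      exact Nat.choose_succ_succ _ _
    rw [h1, Nat.cast_add, ih (by omega)] at h0
    rw [pow_succ]
    linear_combination h0

/-! ### Residue classes of occurrences -/

/-- The `m`-blocks that occur in some row `N`, starting at some position `j`, with `N ≡ ρ` and
`j ≡ α` modulo `p`. -/
def classBlocks (m : ℕ) (ρ α : ZMod p) : Set (Fin m → ZMod p) :=
  {b | ∃ N j : ℕ, (N : ZMod p) = ρ ∧ (j : ZMod p) = α ∧ j + m ≤ N + 1 ∧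
    ∀ i : Fin m, b i = (N.choose (j + i) : ZMod p)}

theorem isAccessible_iff_exists_mem_classBlocks {m : ℕ} (b : Fin m → ZMod p) :
    IsAccessible p (1 + X) b ↔ ∃ ρ α : ZMod p, b ∈ classBlocks m ρ α := by
  rw [isAccessible_one_add_X_iff Fact.out]
  constructor
  · rintro ⟨N, j, h, hb⟩
    exact ⟨N, j, N, j, rfl, rfl, h, hb⟩
  · rintro ⟨ρ, α, N, j, -, -, h, hb⟩
    exact ⟨N, j, h, hb⟩

/-- The linear recurrence satisfied by a block; its coefficients depend only on the residue class
of the occurrence. -/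
theorem classBlocks_recurrence {m : ℕ} {ρ α : ZMod p} {b : Fin m → ZMod p}
    (hb : b ∈ classBlocks m ρ α) (i : ℕ) (hi : i + 1 < m) :
    (α + i + 1) * b ⟨i + 1, hi⟩ = (ρ - α - i) * b ⟨i, by omega⟩ := by
  obtain ⟨N, j, rfl, rfl, -, h⟩ := hb
  rw [h, h]
  have := cast_succ_mul_choose_succ (R := ZMod p) N (j + i)
  push_cast at this
  simp only [← add_assoc]
  rw [this]
  ring

/-- A window of the zero-padded row `N₀`, scaled by `c`, occurs in a longer row, away from both
ends of that row. The longer row comes from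
`(1 + x) ^ (N₀ + p ^ k (c + p)) = (1 + x) ^ N₀ (1 + x ^ (p ^ k)) ^ (c + p)`, whose second factor
has the coefficient `c` at `x ^ (p ^ k)`. -/
theorem exists_padded_occurrence {m N₀ j₀ : ℕ} (c : ZMod p) :
    ∃ N j : ℕ, (N : ZMod p) = N₀ ∧ (j : ZMod p) = j₀ ∧ 1 ≤ j ∧ j + m ≤ N ∧
      ∀ i < m, (N.choose (j + i) : ZMod p) = c * (N₀.choose (j₀ + i) : ZMod p) := by
  have hp : p.Prime := Fact.out
  set k := N₀ + j₀ + m + 1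
  have hlt : k < p ^ k := Nat.lt_pow_self hp.one_lt
  refine ⟨p ^ k * (c.val + p) + N₀, p ^ k * 1 + j₀, ?_, ?_, by omega, ?_, fun i hi => ?_⟩
  · simp [k]
  · simp [k]
  · have : p ^ k * 2 ≤ p ^ k * (c.val + p) := Nat.mul_le_mul_left _ (by have := hp.two_le; omega)
    omega
  · rw [add_assoc, cast_choose_lucas_pow k (by omega) (by omega)]
    simp

theorem smul_choose_mem_classBlocks (m N₀ j₀ : ℕ) (c : ZMod p) :
    (fun i : Fin m => c * (N₀.choose (j₀ + i) : ZMod p)) ∈ classBlocks m (N₀ : ZMod p) j₀ := by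
  obtain ⟨N, j, hN, hj, -, h, hb⟩ := exists_padded_occurrence (m := m) (N₀ := N₀) (j₀ := j₀) c
  exact ⟨N, j, hN, hj, by omega, fun i => (hb i i.2).symm⟩

/-! ### Blocks occurring in several classes -/

/-- The block `c 0 ⋯ 0`. -/
def firstBlock (m : ℕ) (c : ZMod p) : Fin m → ZMod p := fun i => if (i : ℕ) = 0 then c else 0

/-- The block `0 ⋯ 0 c`. -/
def lastBlock (m : ℕ) (c : ZMod p) : Fin m → ZMod p := fun i => if (i : ℕ) + 1 = m then c else 0

/-- The block `c, -c, c, -c, …`. -/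
def altBlock (m : ℕ) (c : ZMod p) : Fin m → ZMod p := fun i => c * (-1) ^ (i : ℕ)

/-- Subtracting the recurrences of two different classes leaves a recurrence with constant
coefficients, so the block is geometric; the original recurrence then restricts the ratio. -/
theorem eq_special_of_mem_two_classes {m : ℕ} (hm : 3 ≤ m) {ρ α ρ' α' : ZMod p}
    {b : Fin m → ZMod p} (h : b ∈ classBlocks m ρ α) (h' : b ∈ classBlocks m ρ' α')
    (hne : (ρ, α) ≠ (ρ', α')) :
    ∃ c, b = firstBlock m c ∨ b = lastBlock m c ∨ b = altBlock m c := by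
  have r1 := classBlocks_recurrence h
  have r2 := classBlocks_recurrence h'
  by_cases hα : α = α'
  · subst hα
    have hρ : ρ - ρ' ≠ 0 := fun h0 => hne (by rw [sub_eq_zero.1 h0])
    refine ⟨b ⟨m - 1, by omega⟩, Or.inr (Or.inl ?_)⟩
    funext ⟨i, hi⟩
    unfold lastBlock
    split_ifs with hc
    · congr 2
      simp only at hc
      omega
    · simp only at hc
      have hz : (ρ - ρ') * b ⟨i, hi⟩ = 0 := by
        linear_combination r2 i (by omega) - r1 i (by omega)
      exact (mul_eq_zero.1 hz).resolve_left hρ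
  · have hα' : α - α' ≠ 0 := sub_ne_zero.2 hα
    obtain ⟨l, hl⟩ : ∃ l : ZMod p, (α - α') * l = ρ - ρ' - (α - α') :=
      ⟨(α - α')⁻¹ * (ρ - ρ' - (α - α')), by rw [mul_inv_cancel_left₀ hα']⟩
    have step : ∀ i (hi : i + 1 < m), b ⟨i + 1, hi⟩ = l * b ⟨i, by omega⟩ := by
      intro i hi
      apply mul_left_cancel₀ hα'
      linear_combination r1 i hi - r2 i hi - b ⟨i, by omega⟩ * hl
    have geom : ∀ i (hi : i < m), b ⟨i, hi⟩ = b ⟨0, by omega⟩ * l ^ i := by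
      intro i
      induction i with
      | zero => intro _; simp
      | succ i ih =>
        intro hi
        rw [step i hi, ih (by omega)]
        ring
    refine ⟨b ⟨0, by omega⟩, ?_⟩
    have e0 := r1 0 (by omega)
    have e1 := r1 1 (by omega)
    rw [geom (0 + 1)] at e0
    rw [geom (1 + 1), geom 1] at e1
    push_cast at e0 e1
    have hz : b ⟨0, by omega⟩ * l * (l + 1) = 0 := by linear_combination e1 - l * e0
    rcases mul_eq_zero.1 hz with h0 | h1
    · left
      funext ⟨i, hi⟩
      rw [geom i hi]
      unfold firstBlock
      split_ifs with hc
      · simp only at hc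
        simp [hc]
      · simp only at hc
        obtain ⟨d, rfl⟩ := Nat.exists_eq_succ_of_ne_zero hc
        rw [pow_succ', ← mul_assoc, h0, zero_mul]
    · right; right
      funext ⟨i, hi⟩
      rw [geom i hi, eq_neg_of_add_eq_zero_left h1]
      rfl

theorem zero_mem_classBlocks (m : ℕ) (ρ α : ZMod p) : (0 : Fin m → ZMod p) ∈ classBlocks m ρ α := by
  have := smul_choose_mem_classBlocks m ρ.val α.val (0 : ZMod p)
  simp only [zero_mul, ZMod.natCast_zmod_val] at this
  exact this

theorem firstBlock_mem_classBlocks_iff {m : ℕ} (hm : 2 ≤ m) {c : ZMod p} (hc : c ≠ 0)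
    (ρ α : ZMod p) : firstBlock m c ∈ classBlocks m ρ α ↔ α = ρ := by
  constructor
  · intro h
    have := classBlocks_recurrence h 0 (by omega)
    simp only [firstBlock] at this
    simp only [zero_add, one_ne_zero, if_false, if_true, mul_zero, Nat.cast_zero, sub_zero] at this
    exact (sub_eq_zero.1 ((mul_eq_zero.1 this.symm).resolve_right hc)).symm
  · rintro rfl
    have := smul_choose_mem_classBlocks m α.val α.val c
    rw [ZMod.natCast_zmod_val] at this
    convert this using 1
    funext i
    unfold firstBlock
    split_ifs with h
    · simp [h]
    · rw [Nat.choose_eq_zero_of_lt (by omega)]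
      simp

theorem lastBlock_mem_classBlocks_iff {m : ℕ} (hm : 2 ≤ m) {c : ZMod p} (hc : c ≠ 0)
    (ρ α : ZMod p) : lastBlock m c ∈ classBlocks m ρ α ↔ α = 1 - m := by
  have hp : p.Prime := Fact.out
  constructor
  · intro h
    have := classBlocks_recurrence h (m - 2) (by omega)
    simp only [lastBlock] at this
    rw [if_pos (by omega), if_neg (by omega), mul_zero] at this
    have h2 := (mul_eq_zero.1 this).resolve_right hc
    rw [Nat.cast_sub hm] at h2
    push_cast at h2
    linear_combination h2
  · rintro rfl
    -- In row `ρ + p ^ l` the coefficient at `x ^ (p ^ l)` is `1`, with zeros before it.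
    set l := p + m with hl
    have hlt : l < p ^ l := Nat.lt_pow_self hp.one_lt
    have hρ := ρ.val_lt
    have := smul_choose_mem_classBlocks m (p ^ l * 1 + ρ.val) (p ^ l - (m - 1)) c
    have e1 : ((p ^ l * 1 + ρ.val : ℕ) : ZMod p) = ρ := by
      have : l ≠ 0 := by omega
      simp [this]
    have e2 : ((p ^ l - (m - 1) : ℕ) : ZMod p) = 1 - m := by
      have : l ≠ 0 := by omega
      rw [Nat.cast_sub (by omega), Nat.cast_sub (by omega)]
      simp [this]
    rw [e1, e2] at this
    convert this using 1
    funext i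
    unfold lastBlock
    split_ifs with h
    · rw [show p ^ l - (m - 1) + (i : ℕ) = p ^ l * 1 + 0 by omega,
        cast_choose_lucas_pow l (by omega) (by omega)]
      simp
    · rw [show p ^ l - (m - 1) + (i : ℕ) = p ^ l * 0 + (p ^ l - (m - 1) + i) by omega,
        cast_choose_lucas_pow l (by omega) (by omega),
        Nat.choose_eq_zero_of_lt (n := ρ.val) (by omega)]
      simp

theorem altBlock_mem_classBlocks_iff {m : ℕ} (hm : 2 ≤ m) {c : ZMod p} (hc : c ≠ 0)
    (ρ α : ZMod p) : altBlock m c ∈ classBlocks m ρ α ↔ ρ = -1 := by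
  have hp : p.Prime := Fact.out
  constructor
  · intro h
    have := classBlocks_recurrence h 0 (by omega)
    simp only [altBlock] at this
    have h2 : c * (ρ + 1) = 0 := by
      push_cast at this
      linear_combination -this
    linear_combination (mul_eq_zero.1 h2).resolve_left hc
  · rintro rfl
    -- Row `p ^ l - 1` alternates; the sign of the scalar adjusts for the starting position.
    set l := p + m with hl
    have hlt : l < p ^ l := Nat.lt_pow_self hp.one_lt
    have hα := α.val_lt
    have := smul_choose_mem_classBlocks m (p ^ l - 1) α.val (c * (-1) ^ α.val)
    have e1 : ((p ^ l - 1 : ℕ) : ZMod p) = -1 := by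
      have : l ≠ 0 := by omega
      rw [Nat.cast_sub (by omega)]
      simp [this]
    rw [e1, ZMod.natCast_zmod_val] at this
    convert this using 1
    funext i
    rw [cast_choose_pow_sub_one l (by omega)]
    unfold altBlock
    have hs : ((-1 : ZMod p) ^ α.val) * (-1) ^ α.val = 1 := by
      rw [← mul_pow]; simp
    rw [pow_add]
    linear_combination -c * (-1) ^ (i : ℕ) * hs

/-! ### The number of blocks in a class -/

/-- The number of digits of row `N` that an `m`-block of row `pN + r` starting at a position
congruent to `s` depends on: the window meets `(s + m - 1) / p + 1` of the substituted words
`d ↦ d * (C(r,0), …, C(r,p-1))`, and the first of them contributes only zeros if `r < s`. -/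
def preimageLength (p m r s : ℕ) : ℕ := (s + m - 1) / p + 1 - (if s ≤ r then 0 else 1)

/-- The `m`-block obtained from the `L`-block `w` by the substitution
`d ↦ d * (C(r,0), …, C(r,p-1))`, starting at offset `s`. If `r < s`, the word containing the
offset `s` consists of zeros from there on, and `w` starts with the digit of the following word. -/
def substBlock (m L r s : ℕ) (w : Fin L → ZMod p) : Fin m → ZMod p := fun i =>
  if h : (s + i) / p - (if s ≤ r then 0 else 1) < L then
    w ⟨(s + i) / p - (if s ≤ r then 0 else 1), h⟩ * (r.choose ((s + i) % p) : ZMod p)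
  else 0

theorem substBlock_injective {m r s : ℕ} (hm : 1 ≤ m) (hr : r < p) (hs : s < p) :
    Function.Injective
      (substBlock (p := p) m (preimageLength p m r s) r s) := by
  have hp : p.Prime := Fact.out
  intro w w' hw
  funext ⟨t, ht⟩
  have ht' := ht
  unfold preimageLength at ht'
  -- Some entry of the block is a nonzero multiple of the digit `t`.
  obtain ⟨i, him, hidx, hne⟩ : ∃ i, i < m ∧ (s + i) / p - (if s ≤ r then 0 else 1) = t ∧
      (r.choose ((s + i) % p) : ZMod p) ≠ 0 := by
    by_cases hcase : s ≤ p * (t + if s ≤ r then 0 else 1)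
    · refine ⟨p * (t + if s ≤ r then 0 else 1) - s, ?_, ?_, ?_⟩
      · have h1 : t + (if s ≤ r then 0 else 1) ≤ (s + m - 1) / p := by omega
        have h2 := (Nat.le_div_iff_mul_le hp.pos).1 h1
        rw [mul_comm] at h2
        omega
      · rw [Nat.add_sub_cancel' hcase, Nat.mul_div_cancel_left _ hp.pos]
        omega
      · rw [Nat.add_sub_cancel' hcase, Nat.mul_mod_right]
        simp
    · have h0 : t + (if s ≤ r then 0 else 1) = 0 := by
        by_contra h
        apply hcase
        calc s ≤ p * 1 := by omega
          _ ≤ _ := Nat.mul_le_mul_left _ (by omega)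
      have hsr : s ≤ r := by
        by_contra h
        rw [if_neg h] at h0
        omega
      refine ⟨0, hm, ?_, ?_⟩
      · rw [add_zero, Nat.div_eq_of_lt hs]
        omega
      · rw [add_zero, Nat.mod_eq_of_lt hs]
        exact cast_choose_ne_zero hr hsr
  have h := congrFun hw ⟨i, him⟩
  subst hidx
  simp only [substBlock] at h
  rw [dif_pos ht, dif_pos ht] at h
  exact mul_right_cancel₀ hne h

theorem substBlock_image {m : ℕ} (hm : 1 ≤ m) (ρ α : ZMod p) :
    substBlock m (preimageLength p m ρ.val α.val) ρ.val α.val ''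
      {w | IsAccessible p (1 + X) w} = classBlocks m ρ α := by
  have hp : p.Prime := Fact.out
  have hr := ρ.val_lt
  have hs := α.val_lt
  set r := ρ.val with hrdef
  set s := α.val with hsdef
  have hδ : (if s ≤ r then 0 else 1) ≤ 1 := by split_ifs <;> omega
  -- The substitution turns a window of row `N` into a window of row `pN + r`.
  have key : ∀ (N q : ℕ) (w : Fin (preimageLength p m r s) → ZMod p),
      (∀ t, w t = (N.choose (q + (if s ≤ r then 0 else 1) + t) : ZMod p)) → ∀ i : Fin m,
      substBlock m (preimageLength p m r s) r s w i =
        ((p * N + r).choose (p * q + s + i) : ZMod p) := by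
    intro N q w hw i
    have hi : (s + i) / p - (if s ≤ r then 0 else 1) < preimageLength p m r s ∨
        (s + i) / p < (if s ≤ r then 0 else 1) := by
      have : (s + i) / p ≤ (s + m - 1) / p := Nat.div_le_div_right (by omega)
      unfold preimageLength
      omega
    have hpos : p * q + s + i = p * (q + (s + i) / p) + (s + i) % p := by
      have := Nat.div_add_mod (s + i) p
      rw [mul_add]
      omega
    rw [hpos, cast_choose_lucas hr (Nat.mod_lt _ hp.pos)]
    by_cases hlt : (s + i) / p < (if s ≤ r then 0 else 1)
    · -- The window starts in the zeros following the last entry of a substituted word.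
      have hsr : ¬ s ≤ r := by
        intro h
        rw [if_pos h] at hlt
        exact Nat.not_lt_zero _ hlt
      rw [if_neg hsr] at hlt
      have hz : (r.choose ((s + i) % p) : ZMod p) = 0 := by
        have h3 := Nat.div_add_mod (s + i) p
        rw [Nat.lt_one_iff.1 hlt] at h3
        rw [Nat.choose_eq_zero_of_lt (by omega), Nat.cast_zero]
      simp only [substBlock]
      rw [hz]
      simp
    · have hi := hi.resolve_right hlt
      simp only [substBlock]
      rw [dif_pos hi, hw]
      rw [add_assoc, Nat.add_sub_cancel' (not_lt.1 hlt)]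
  ext b
  constructor
  · rintro ⟨w, hw, rfl⟩
    obtain ⟨N₀, j₀, -, hw⟩ := (isAccessible_one_add_X_iff hp w).1 hw
    obtain ⟨N, j, -, -, hj, hjN, hpad⟩ := exists_padded_occurrence
      (m := preimageLength p m r s) (N₀ := N₀) (j₀ := j₀) (1 : ZMod p)
    refine ⟨p * N + r, p * (j - if s ≤ r then 0 else 1) + s, ?_, ?_, ?_, ?_⟩
    · simp [hrdef]
    · simp [hsdef]
    · have h1 : s + m - 1 < p * ((s + m - 1) / p + 1) := Nat.lt_mul_div_succ _ hp.pos
      have h2 : p * (j - if s ≤ r then 0 else 1) + p * ((s + m - 1) / p + 1) ≤ p * N := by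
        rw [← mul_add]
        apply Nat.mul_le_mul_left
        unfold preimageLength at hjN
        omega
      omega
    · apply key
      intro t
      rw [Nat.sub_add_cancel (hδ.trans hj), hpad t t.2, hw, one_mul]
  · rintro ⟨N, j, hN, hj, hjN, hb⟩
    have hN' : N % p = r := by rw [hrdef, ← hN, ZMod.val_natCast]
    have hj' : j % p = s := by rw [hsdef, ← hj, ZMod.val_natCast]
    have eN : p * (N / p) + r = N := by rw [← hN']; exact Nat.div_add_mod _ _
    have ej : p * (j / p) + s = j := by rw [← hj']; exact Nat.div_add_mod _ _
    refine ⟨fun t => ((N / p).choose (j / p + (if s ≤ r then 0 else 1) + t) : ZMod p), ?_, ?_⟩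
    · rw [Set.mem_ofPred_eq, isAccessible_one_add_X_iff hp]
      refine ⟨N / p, j / p + (if s ≤ r then 0 else 1), ?_, fun _ => rfl⟩
      have h1 : p * (j / p + (s + m - 1) / p) < p * (N / p + 1) := by
        have := Nat.mul_div_le (s + m - 1) p
        rw [mul_add, mul_add]
        omega
      have h2 := Nat.lt_of_mul_lt_mul_left h1
      unfold preimageLength
      generalize (s + m - 1) / p = x at *
      generalize j / p = y at *
      generalize N / p = z at *
      omega
    · funext i
      rw [key (N / p) (j / p) _ (fun _ => rfl) i, eN, ej, hb]

theorem ncard_classBlocks {m : ℕ} (hm : 1 ≤ m) (ρ α : ZMod p) :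
    (classBlocks m ρ α).ncard = numAccessible (1 + X) p (preimageLength p m ρ.val α.val) := by
  rw [← substBlock_image hm, Set.ncard_image_of_injective _
    (substBlock_injective hm ρ.val_lt α.val_lt)]
  rfl

end Prime

section Counting

variable {p : ℕ} [Fact p.Prime]

/-! ### Double counting -/

open Classical in
/-- The number of classes in which a block of length at least `3` occurs: exactly one for an
accessible block, apart from the zero block and three families of blocks. -/
theorem card_classes {m : ℕ} (hm : 3 ≤ m) (b : Fin m → ZMod p) :
    (∑ x : ZMod p × ZMod p, if b ∈ classBlocks m x.1 x.2 then (1 : ℚ) else 0) =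
      (if IsAccessible p (1 + X) b then 1 else 0)
      + (if b = 0 then (p : ℚ) ^ 2 - 1 else 0)
      + (if b ∈ firstBlock m '' {0}ᶜ then (p : ℚ) - 1 else 0)
      + (if b ∈ lastBlock m '' {0}ᶜ then (p : ℚ) - 1 else 0)
      + (if b ∈ altBlock m '' {0}ᶜ then (p : ℚ) - 1 else 0) := by
  have hm0 : 0 < m := by omega
  have hm1 : 1 < m := by omega
  have hml : m - 1 < m := by omega
  -- The entries at `0`, `1` and `m - 1` tell the zero block and the three families apart.
  have mz : b = 0 → b ⟨0, hm0⟩ = 0 ∧ b ⟨m - 1, hml⟩ = 0 := by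
    rintro rfl
    exact ⟨rfl, rfl⟩
  have mf : b ∈ firstBlock m '' {0}ᶜ → b ⟨0, hm0⟩ ≠ 0 ∧ b ⟨1, hm1⟩ = 0 := by
    rintro ⟨c, hc, rfl⟩
    simpa [firstBlock] using hc
  have ml : b ∈ lastBlock m '' {0}ᶜ → b ⟨0, hm0⟩ = 0 ∧ b ⟨m - 1, hml⟩ ≠ 0 := by
    rintro ⟨c, hc, rfl⟩
    simp only [lastBlock]
    rw [if_neg (by omega), if_pos (by omega)]
    exact ⟨rfl, hc⟩
  have ma : b ∈ altBlock m '' {0}ᶜ → b ⟨0, hm0⟩ ≠ 0 ∧ b ⟨1, hm1⟩ ≠ 0 := by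
    rintro ⟨c, hc, rfl⟩
    simpa [altBlock] using hc
  rw [isAccessible_iff_exists_mem_classBlocks]
  by_cases hz : b = 0
  · rw [if_neg (mt mf (by tauto)), if_neg (mt ml (by tauto)), if_neg (mt ma (by tauto)),
      if_pos hz]
    subst hz
    simp only [zero_mem_classBlocks, exists_const, if_true]
    simp
    ring
  by_cases hf : b ∈ firstBlock m '' {0}ᶜ
  · rw [if_neg (mt ml (by tauto)), if_neg (mt ma (by tauto)), if_neg hz, if_pos hf]
    obtain ⟨c, hc, rfl⟩ := hf
    simp only [firstBlock_mem_classBlocks_iff (by omega : 2 ≤ m) hc, Fintype.sum_prod_type]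
    simp
  by_cases hl : b ∈ lastBlock m '' {0}ᶜ
  · rw [if_neg (mt ma (by tauto)), if_neg hz, if_neg hf, if_pos hl]
    obtain ⟨c, hc, rfl⟩ := hl
    simp only [lastBlock_mem_classBlocks_iff (by omega : 2 ≤ m) hc, Fintype.sum_prod_type]
    simp
  by_cases ha : b ∈ altBlock m '' {0}ᶜ
  · rw [if_neg hz, if_neg hf, if_neg hl, if_pos ha]
    obtain ⟨c, hc, rfl⟩ := ha
    simp only [altBlock_mem_classBlocks_iff (by omega : 2 ≤ m) hc, Fintype.sum_prod_type_right]
    simp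
  rw [if_neg hz, if_neg hf, if_neg hl, if_neg ha]
  simp only [add_zero]
  split_ifs with hex
  · obtain ⟨ρ, α, h⟩ := hex
    rw [Finset.sum_eq_single (ρ, α), if_pos h]
    · rintro ⟨ρ', α'⟩ - hne
      refine if_neg fun h' => ?_
      obtain ⟨c, hc⟩ := eq_special_of_mem_two_classes hm h' h hne
      have hc0 : c ≠ 0 := by
        rintro rfl
        apply hz
        rcases hc with rfl | rfl | rfl <;> funext i <;> simp [firstBlock, lastBlock, altBlock]
      rcases hc with h | h | h
      · exact hf ⟨c, hc0, h.symm⟩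
      · exact hl ⟨c, hc0, h.symm⟩
      · exact ha ⟨c, hc0, h.symm⟩
    · simp
  · refine Finset.sum_eq_zero fun x _ => if_neg fun h => hex ⟨_, _, h⟩

open Classical in
theorem sum_indicator_eq_ncard_mul {β : Type*} [Fintype β] (s : Set β) (c : ℚ) :
    (∑ b, if b ∈ s then c else 0) = s.ncard * c := by
  rw [← Finset.sum_filter, Finset.sum_const, nsmul_eq_mul, Set.ncard_eq_toFinset_card']
  congr 3
  ext
  simp

theorem ncard_compl_zero : (({0}ᶜ : Set (ZMod p)).ncard : ℚ) = p - 1 := by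
  have h := Set.ncard_add_ncard_compl ({0} : Set (ZMod p))
  rw [Set.ncard_singleton, Nat.card_eq_fintype_card, ZMod.card] at h
  have h' : (1 : ℚ) + (({0}ᶜ : Set (ZMod p)).ncard : ℚ) = p := by exact_mod_cast h
  linarith

theorem sum_ncard_classBlocks {m : ℕ} (hm : 3 ≤ m) :
    (∑ x : ZMod p × ZMod p, ((classBlocks m x.1 x.2).ncard : ℚ)) =
      numAccessible (1 + X) p m + (2 * (p : ℚ) - 1) * (2 * (p : ℚ) - 2) := by
  classical
  have h : ∀ x : ZMod p × ZMod p, ((classBlocks m x.1 x.2).ncard : ℚ) =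
      ∑ b, if b ∈ classBlocks m x.1 x.2 then (1 : ℚ) else 0 := fun x => by
    rw [sum_indicator_eq_ncard_mul, mul_one]
  have hf : Function.Injective (firstBlock (p := p) m) := fun c d h => by
    simpa [firstBlock] using congrFun h ⟨0, by omega⟩
  have hl : Function.Injective (lastBlock (p := p) m) := fun c d h => by
    have := congrFun h ⟨m - 1, by omega⟩
    simp only [lastBlock] at this
    rwa [if_pos (by omega), if_pos (by omega)] at this
  have ha : Function.Injective (altBlock (p := p) m) := fun c d h => by
    simpa [altBlock] using congrFun h ⟨0, by omega⟩
  have hacc := sum_indicator_eq_ncard_mul {b : Fin m → ZMod p | IsAccessible p (1 + X) b} 1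
  have hzero := sum_indicator_eq_ncard_mul ({0} : Set (Fin m → ZMod p)) ((p : ℚ) ^ 2 - 1)
  simp only [Set.mem_ofPred_eq, Set.mem_singleton_iff, Set.ncard_singleton] at hacc hzero
  simp only [h]
  rw [Finset.sum_comm]
  simp only [card_classes hm, Finset.sum_add_distrib]
  rw [hacc, hzero]
  simp only [sum_indicator_eq_ncard_mul, Set.ncard_image_of_injective _ hf,
    Set.ncard_image_of_injective _ hl, Set.ncard_image_of_injective _ ha, ncard_compl_zero]
  unfold numAccessible
  push_cast
  ring

/-! ### Summation over the residue classes -/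

theorem sum_zmod_val {M : Type*} [AddCommMonoid M] (f : ℕ → M) :
    ∑ x : ZMod p, f x.val = ∑ r ∈ Finset.range p, f r := by
  refine Finset.sum_bij (fun x _ => x.val) (fun x _ => Finset.mem_range.2 x.val_lt)
    (fun x _ y _ h => ZMod.val_injective p h) (fun r hr => ?_) (fun _ _ => rfl)
  exact ⟨(r : ZMod p), Finset.mem_univ _, ZMod.val_cast_of_lt (Finset.mem_range.1 hr)⟩

end Counting

/-- For a fixed starting offset `s`, the residues `r ≥ s` see one digit more than the others. -/
theorem sum_preimageLength {p s m : ℕ} (hs : s ≤ p) (a : ℕ → ℚ) :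
    ∑ r ∈ Finset.range p, a (preimageLength p m r s) =
      s * a ((s + m - 1) / p) + ((p : ℚ) - s) * a ((s + m - 1) / p + 1) := by
  obtain ⟨d, rfl⟩ := Nat.exists_eq_add_of_le hs
  rw [Finset.sum_range_add]
  have h1 : ∀ r ∈ Finset.range s, a (preimageLength (s + d) m r s) = a ((s + m - 1) / (s + d)) := by
    intro r hr
    rw [preimageLength, if_neg (by simpa using hr), Nat.add_sub_cancel]
  have h2 : ∀ r ∈ Finset.range d,
      a (preimageLength (s + d) m (s + r) s) = a ((s + m - 1) / (s + d) + 1) := by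
    intro r _
    rw [preimageLength, if_pos (by omega), Nat.sub_zero]
  rw [Finset.sum_congr rfl h1, Finset.sum_congr rfl h2]
  simp

theorem sum_range_affine (K : ℕ) {f : ℕ → ℚ} {x y : ℚ} (hf : ∀ s, f s = x + s * y) :
    ∑ s ∈ Finset.range K, f s = K * x + (K : ℚ) * (K - 1) / 2 * y := by
  induction K with
  | zero => simp
  | succ K ih =>
    rw [Finset.sum_range_succ, ih, hf]
    push_cast
    ring

/-- The window of length `pn + k` starting at offset `s < p` meets `n + 1` words if
`s + k ≤ p` and `n + 2` otherwise, except that it meets only `n` words if `s = k = 0`. -/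
theorem sum_sum_preimageLength {p n k : ℕ} (hk : k < p) (hm : 1 ≤ p * n + k) (a : ℕ → ℚ) :
    ∑ s ∈ Finset.range p, ∑ r ∈ Finset.range p, a (preimageLength p (p * n + k) r s) =
      ((p : ℚ) - k) * ((p : ℚ) - k + 1) / 2 * a n
        + ((k : ℚ) * p + k - (k : ℚ) ^ 2 + ((p : ℚ) ^ 2 - p) / 2) * a (n + 1)
        + ((k : ℚ) ^ 2 - k) / 2 * a (n + 2) := by
  have hp : 0 < p := by omega
  rw [Finset.sum_congr rfl fun s hs => sum_preimageLength (Finset.mem_range.1 hs).le a]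
  rcases Nat.eq_zero_or_pos k with rfl | hk0
  · have hn : n ≠ 0 := by
      rintro rfl
      omega
    obtain ⟨n, rfl⟩ := Nat.exists_eq_add_one_of_ne_zero hn
    obtain ⟨q, rfl⟩ := Nat.exists_eq_add_one_of_ne_zero hp.ne'
    rw [Finset.sum_range_succ']
    have h0 : (0 + ((q + 1) * (n + 1) + 0) - 1) / (q + 1) = n := by
      rw [show 0 + ((q + 1) * (n + 1) + 0) - 1 = (q + 1) * n + q by rw [mul_add]; omega,
        Nat.mul_add_div hp, Nat.div_eq_of_lt (by omega), add_zero]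
    have h1 : ∀ s ∈ Finset.range q,
        (s + 1 + ((q + 1) * (n + 1) + 0) - 1) / (q + 1) = n + 1 := by
      intro s hs
      have := Finset.mem_range.1 hs
      rw [show s + 1 + ((q + 1) * (n + 1) + 0) - 1 = (q + 1) * (n + 1) + s by omega,
        Nat.mul_add_div hp, Nat.div_eq_of_lt (by omega), add_zero]
    rw [h0, Finset.sum_congr rfl fun s hs => by rw [h1 s hs]]
    rw [sum_range_affine q (x := a (n + 1) + q * a (n + 2)) (y := a (n + 1) - a (n + 2))
      fun s => by push_cast; ring]
    push_cast
    ring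
  · obtain ⟨k, rfl⟩ := Nat.exists_eq_add_one_of_ne_zero hk0.ne'
    obtain ⟨d, rfl⟩ : ∃ d, p = d + 2 + k := ⟨p - 2 - k, by omega⟩
    -- The offsets `s < d + 2` are those with `s + (k + 1) ≤ p`.
    rw [Finset.sum_range_add _ (d + 2) k]
    have h1 : ∀ s ∈ Finset.range (d + 2),
        (s + ((d + 2 + k) * n + (k + 1)) - 1) / (d + 2 + k) = n := by
      intro s hs
      have := Finset.mem_range.1 hs
      rw [show s + ((d + 2 + k) * n + (k + 1)) - 1 = (d + 2 + k) * n + (s + k) by omega,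
        Nat.mul_add_div hp, Nat.div_eq_of_lt (by omega), add_zero]
    have h2 : ∀ s ∈ Finset.range k,
        (d + 2 + s + ((d + 2 + k) * n + (k + 1)) - 1) / (d + 2 + k) = n + 1 := by
      intro s hs
      have := Finset.mem_range.1 hs
      rw [show d + 2 + s + ((d + 2 + k) * n + (k + 1)) - 1 =
          (d + 2 + k) * (n + 1) + s by rw [mul_add]; omega,
        Nat.mul_add_div hp, Nat.div_eq_of_lt (by omega), add_zero]
    rw [Finset.sum_congr rfl fun s hs => by rw [h1 s hs],
      Finset.sum_congr (s₁ := Finset.range k) rfl fun s hs => by rw [h2 s hs]]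
    rw [sum_range_affine (d + 2) (x := (d + 2 + k) * a (n + 1)) (y := a n - a (n + 1))
        fun s => by push_cast; ring,
      sum_range_affine k (x := (d + 2) * a (n + 1) + k * a (n + 2))
        (y := a (n + 1) - a (n + 2)) fun s => by push_cast; ring]
    push_cast
    ring

/-! ### Short blocks -/

theorem numAccessible_zero (p : ℕ) : numAccessible (1 + X) p 0 = 1 := by
  have : {b : Fin 0 → ZMod p | IsAccessible p (1 + X) b} = Set.univ :=
    Set.eq_univ_of_forall fun b => ⟨0, 0, by omega, fun i => i.elim0⟩
  rw [numAccessible, this, Set.ncard_univ, Nat.card_unique]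

section Short

variable {p : ℕ} [Fact p.Prime]

theorem numAccessible_eq_pow {m : ℕ}
    (h : ∀ b : Fin m → ZMod p, ∃ ρ α : ZMod p, b ∈ classBlocks m ρ α) :
    numAccessible (1 + X) p m = p ^ m := by
  have : {b : Fin m → ZMod p | IsAccessible p (1 + X) b} = Set.univ :=
    Set.eq_univ_of_forall fun b => (isAccessible_iff_exists_mem_classBlocks b).2 (h b)
  rw [numAccessible, this, Set.ncard_univ, Nat.card_eq_fintype_card]
  simp [ZMod.card]

theorem numAccessible_one : numAccessible (1 + X) p 1 = p := by
  rw [numAccessible_eq_pow, pow_one]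
  intro b
  refine ⟨(0 : ℕ), (0 : ℕ), ?_⟩
  convert smul_choose_mem_classBlocks 1 0 0 (b 0) using 1
  funext i
  fin_cases i
  simp

theorem numAccessible_two : numAccessible (1 + X) p 2 = p ^ 2 := by
  apply numAccessible_eq_pow
  intro b
  by_cases h0 : b 0 = 0
  · by_cases h1 : b 1 = 0
    · refine ⟨0, 0, ?_⟩
      convert zero_mem_classBlocks (p := p) 2 0 0 using 1
      funext i
      fin_cases i <;> simpa
    · refine ⟨0, 1 - (2 : ℕ), ?_⟩
      convert (lastBlock_mem_classBlocks_iff (le_refl 2) h1 0 _).2 rfl using 1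
      funext i
      fin_cases i <;> simp [lastBlock, h0]
  · -- Row `r` begins with `1, r`.
    refine ⟨((b 1 / b 0).val : ℕ), (0 : ℕ), ?_⟩
    convert smul_choose_mem_classBlocks 2 (b 1 / b 0).val 0 (b 0) using 1
    funext i
    fin_cases i
    · simp
    · simp [mul_div_cancel₀, h0]

end Short

/-! ### The recursion -/

theorem mainTheorem2 (p : ℕ) (hp : p.Prime) (hp3 : 3 ≤ p) :
    numAccessible (1 + X) p 0 = 1 ∧
    numAccessible (1 + X) p 1 = p ∧
    numAccessible (1 + X) p 2 = p ^ 2 ∧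
    ∀ n k : ℕ, k ≤ p - 1 → 3 ≤ p * n + k →
      (numAccessible (1 + X) p (p * n + k) : ℚ) =
        ((p : ℚ) - k) * ((p : ℚ) - k + 1) / 2 * (numAccessible (1 + X) p n : ℚ)
        + ((k : ℚ) * p + k - (k : ℚ) ^ 2 + ((p : ℚ) ^ 2 - p) / 2)
            * (numAccessible (1 + X) p (n + 1) : ℚ)
        + ((k : ℚ) ^ 2 - k) / 2 * (numAccessible (1 + X) p (n + 2) : ℚ)
        - (2 * (p : ℚ) - 1) * (2 * (p : ℚ) - 2) := by
  have := Fact.mk hp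
  refine ⟨numAccessible_zero p, numAccessible_one, numAccessible_two, fun n k hk hm => ?_⟩
  rw [← sum_sum_preimageLength (by omega) (by omega)
    (fun L => (numAccessible (1 + X) p L : ℚ)), eq_sub_iff_add_eq, ← sum_ncard_classBlocks hm,
    Fintype.sum_prod_type_right]
  simp only [ncard_classBlocks (by omega : 1 ≤ p * n + k)]
  rw [← sum_zmod_val]
  refine Finset.sum_congr rfl fun α _ => ?_
  rw [← sum_zmod_val]
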